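/- Let $M\ge 2$ be an integer, $m>0$, $\bar\gamma>0$, and let $f_\gamma(x)=\frac{(m/\bar\gamma)^m}{\Gamma(m)}x^{m-1}e^{-mx/\bar\gamma}$ $(x>0)$ be the density of the instantaneous signal-to-noise ratio of the Nakagami-$m$ channel (gamma distribution with shape $m$ and mean $\bar\gamma$). Put $$c_0=\frac{\sqrt M-1}{\sqrt M\,\log_2 M},\qquad c_1=\frac{3\log_2 M}{2(M-1)},\qquad Q(z)=\frac1{\sqrt{2\pi}}\int_z^\infty e^{-t^2/2}\,dt .$$ Let $B$ be the beta function, $I_x(a,b)=\frac1{B(a,b)}\int_0^x t^{a-1}(1-t)^{b-1}\,dt$ the regularized incomplete beta function, $(a)_n=a(a+1)\cdots(a+n-1)$, and $$F_1(a;b,b';c;u,v)=\frac1{B(a,c-a)}\int_0^1 t^{a-1}(1-t)^{c-a-1}(1-ut)^{-b}(1-vt)^{-b'}\,dt\qquad(0<a<c,\ u,v<1)$$ the Appell hypergeometric function. For $\alpha>0$ put $b=\frac{m}{\alpha\bar\gamma}$ and $$R_2(\alpha,\bar\gamma,m)=\frac{b^m}{4\pi}\sum_{n=0}^\infty\frac{(1-m)_n\,B(n+m+1,\frac12)}{n!\,(n+\frac12)\,B(\frac12,m)}\,F_1\!\left(n+m+1;\,m,\,n+\tfrac12;\,m+n+\tfrac32;\,-b,\,-(1+b)\right).$$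 (1) For the exact bit error rate of $M$-QAM, $\mathrm{BER}_{th}(x)=4c_0Q(\sqrt{2c_1x})-4c_0^2Q^2(\sqrt{2c_1x})$, the average over $f_\gamma$ is a convergent integral, the series $R_2(c_1,\bar\gamma,m)$ converges absolutely, and $$\int_0^\infty \mathrm{BER}_{th}(x)f_\gamma(x)\,dx=c_0(2-c_0)\,I_{\frac{m}{m+c_1\bar\gamma}}\!\left(m,\tfrac12\right)+4c_0^2R_2(c_1,\bar\gamma,m).$$ (2) For the approximate bit error rate $\mathrm{BER}_{ap}(x)=4c_0\sum_{1\le j\le\sqrt M/2}Q\big(\sqrt{2c_1(2j-1)^2x}\big)$ the average is a convergent integral and $$\int_0^\infty \mathrm{BER}_{ap}(x)f_\gamma(x)\,dx=2c_0\sum_{1\le j\le\sqrt M/2}I_{\frac{m}{m+c_1(2j-1)^2\bar\gamma}}\!\left(m,\tfrac12\right).$$ If $\mathrm{BER}_{ap}$ is instead taken with the arguments $\sqrt{c_1(2j-1)^2x}$ in place of $\sqrt{2c_1(2j-1)^2x}$, the average is again a convergent integral, and the same formula holds with $c_1$ replaced by $c_1/2$ on the right-hand side. -/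

import Mathlib

noncomputable section

namespace NakagamiQAM

/-- The Gaussian Q-function `Q(z) = (2π)^(-1/2) ∫_z^∞ exp(-t²/2) dt`. -/
def gaussQ (z : ℝ) : ℝ :=
  (√(2 * Real.pi))⁻¹ * ∫ t in Set.Ioi z, Real.exp (-t ^ 2 / 2)

/-- The probability density of the instantaneous SNR of the Nakagami-m channel: the gamma
density of shape `m` and mean `g`, that is, of rate `m / g`. -/
def snrPDF (m g x : ℝ) : ℝ :=
  ProbabilityTheory.gammaPDFReal m (m / g) x

/-- The average of an instantaneous bit error rate over the SNR of the Nakagami-m channel. -/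
def averageBER (ber : ℝ → ℝ) (m g : ℝ) : ℝ :=
  ∫ x in Set.Ioi (0 : ℝ), ber x * snrPDF m g x

/-- The average of `ber` over the SNR of the Nakagami-m channel is a convergent integral. -/
def HasAverageBER (ber : ℝ → ℝ) (m g : ℝ) : Prop :=
  MeasureTheory.IntegrableOn (fun x => ber x * snrPDF m g x) (Set.Ioi (0 : ℝ))

/-- `c₀ = (√M - 1) / (√M log₂ M)`. -/
def c₀ (M : ℕ) : ℝ := (√(M : ℝ) - 1) / (√(M : ℝ) * Real.logb 2 M)

/-- `c₁ = 3 log₂ M / (2 (M - 1))`. -/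
def c₁ (M : ℕ) : ℝ := 3 * Real.logb 2 M / (2 * ((M : ℝ) - 1))

/-- The instantaneous bit error rate of M-QAM at SNR `x`. -/
def berTh (M : ℕ) (x : ℝ) : ℝ :=
  4 * c₀ M * gaussQ √(2 * c₁ M * x) - 4 * c₀ M ^ 2 * gaussQ √(2 * c₁ M * x) ^ 2

/-- The approximate bit error rate `a₁ ∑_{j=1}^{a₃} Q(√(a₂(j) x))` at SNR `x`. -/
def berAp (a₁ : ℝ) (a₂ : ℕ → ℝ) (a₃ : ℕ) (x : ℝ) : ℝ :=
  a₁ * ∑ j ∈ Finset.Icc 1 a₃, gaussQ √(a₂ j * x)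

/-- The regularized incomplete beta function `I_x(a, b) = B_x(a, b) / B(a, b)`,
for `0 ≤ x ≤ 1` and `a, b > 0`. -/
def regIncBeta (x a b : ℝ) : ℝ :=
  (∫ t in (0 : ℝ)..x, t ^ (a - 1) * (1 - t) ^ (b - 1)) / ProbabilityTheory.beta a b

/-- The Appell hypergeometric function `F₁(a; b, b'; c; u, v)` for `0 < a < c` and `u, v < 1`,
given by its Euler integral. -/
def appellF1 (a b b' c u v : ℝ) : ℝ :=
  (∫ t in (0 : ℝ)..1,
      t ^ (a - 1) * (1 - t) ^ (c - a - 1) * (1 - u * t) ^ (-b) * (1 - v * t) ^ (-b')) /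
    ProbabilityTheory.beta a (c - a)

/-- The `n`-th term of the series in the definition of `R₂(α, g, m)`. -/
def R₂Term (α g m : ℝ) (n : ℕ) : ℝ :=
  (ascPochhammer ℝ n).eval (1 - m) * ProbabilityTheory.beta (n + m + 1) (1 / 2) /
      ((n.factorial : ℝ) * (n + 1 / 2) * ProbabilityTheory.beta (1 / 2) m) *
    appellF1 (n + m + 1) m (n + 1 / 2) (m + n + 3 / 2) (-(m / (α * g))) (-(1 + m / (α * g)))

/-- The function `R₂(α, g, m)`, a series of Appell `F₁` functions. -/
def R₂ (α g m : ℝ) : ℝ :=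
  (m / (α * g)) ^ m / (4 * Real.pi) * ∑' n : ℕ, R₂Term α g m n

end NakagamiQAM

end

noncomputable section

open MeasureTheory Set

namespace NakagamiQAM

/-! Everything reduces to averaging Q and Q² over a gamma density; scaling the variable by α turns
its rate into b = m/(αg). The substitution w = r² writes Q(√(2y)) as a constant times √y ∫ w^(-1/2)
e^(-yw) dw over w > 1, and 1/2 - Q is the same expression over 0 < w < 1. Integrating out the SNR
first (Tonelli) leaves a gamma integral in w, which a fractional linear substitution turns into an
incomplete beta integral. This gives the average of Q (`averageBER_gaussQ`), hence the approximate
error rate by linearity.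

For the square, Q² = Q/2 - Q(1/2 - Q), and R₂ is exactly the average of Q(1/2 - Q)
(`averageBER_gaussQ_mul_half_sub`). There Q is written by Craig's formula as a mixture of
exponentials e^(-z/t), which only raise the gamma rate from b to b + 1/t. The averaged factor 1/2 -
Q then gives the incomplete beta integral B_x(1/2, m) at x = t/(1 + (1+b)t) ≤ 1/2. Its binomial
expansion in x integrates termwise in t, and each term is an Euler integral of F₁ (`R₂Term_eq`,
`hasSum_R₂Term`). -/

/-! ### Tonelli and Laplace transforms. -/

/-- Tonelli's theorem for the Bochner integral of a nonnegative function on a product set, all of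
whose sections are integrable. -/
lemma setIntegral_swap_of_nonneg {s t : Set ℝ} (hs : MeasurableSet s) (ht : MeasurableSet t)
    {f : ℝ → ℝ → ℝ} (hf : Measurable (Function.uncurry f))
    (h0 : ∀ x ∈ s, ∀ y ∈ t, 0 ≤ f x y) (h1 : ∀ x ∈ s, IntegrableOn (f x) t)
    (h2 : ∀ y ∈ t, IntegrableOn (fun x => f x y) s) :
    ∫ x in s, ∫ y in t, f x y = ∫ y in t, ∫ x in s, f x y := by
  have hf' : Measurable (Function.uncurry fun y x => f x y) := hf.comp measurable_swap
  rw [integral_eq_lintegral_of_nonneg_ae, integral_eq_lintegral_of_nonneg_ae]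
  · congr 1
    have e1 : ∫⁻ x in s, ENNReal.ofReal (∫ y in t, f x y) =
        ∫⁻ x in s, ∫⁻ y in t, ENNReal.ofReal (f x y) :=
      setLIntegral_congr_fun hs fun x hx => ofReal_integral_eq_lintegral_ofReal (h1 x hx)
        (ae_restrict_of_forall_mem ht (h0 x hx))
    have e2 : ∫⁻ y in t, ENNReal.ofReal (∫ x in s, f x y) =
        ∫⁻ y in t, ∫⁻ x in s, ENNReal.ofReal (f x y) :=
      setLIntegral_congr_fun ht fun y hy => ofReal_integral_eq_lintegral_ofReal (h2 y hy)
        (ae_restrict_of_forall_mem hs fun x hx => h0 x hx y hy)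
    rw [e1, e2]
    exact lintegral_lintegral_swap hf.ennreal_ofReal.aemeasurable
  · exact ae_restrict_of_forall_mem ht fun y hy =>
      setIntegral_nonneg hs fun x hx => h0 x hx y hy
  · exact hf'.stronglyMeasurable.integral_prod_right.aestronglyMeasurable
  · exact ae_restrict_of_forall_mem hs fun x hx => setIntegral_nonneg ht fun y hy => h0 x hx y hy
  · exact hf.stronglyMeasurable.integral_prod_right.aestronglyMeasurable

lemma integrableOn_rpow_mul_exp_neg_mul {a r : ℝ} (ha : 0 < a) (hr : 0 < r) :
    IntegrableOn (fun x : ℝ => x ^ (a - 1) * Real.exp (-(r * x))) (Ioi 0) := by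
  have := integrableOn_rpow_mul_exp_neg_mul_rpow (p := 1) (s := a - 1) (b := r)
    (by linarith) one_pos hr
  simpa [neg_mul] using this

/-- A weighted Laplace transform of an incomplete gamma integral, as an Euler integral. -/
lemma integral_rpow_mul_exp_mul_integral {m β : ℝ} (hm : 0 < m) (hβ : 0 < β) {S : Set ℝ}
    (hS : MeasurableSet S) (hS0 : S ⊆ Ioi 0) :
    ∫ x in Ioi (0 : ℝ), x ^ (m - 1) * Real.exp (-(β * x)) *
        (x ^ (1 / 2 : ℝ) * ∫ w in S, w ^ ((1 / 2 : ℝ) - 1) * Real.exp (-(x * w))) =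
      Real.Gamma (m + 1 / 2) *
        ∫ w in S, w ^ ((1 / 2 : ℝ) - 1) * (1 / (β + w)) ^ (m + 1 / 2) := by
  have hpt : ∀ x ∈ Ioi (0 : ℝ), ∀ w, x ^ (m - 1) * Real.exp (-(β * x)) *
      (x ^ (1 / 2 : ℝ) * (w ^ ((1 / 2 : ℝ) - 1) * Real.exp (-(x * w)))) =
      w ^ ((1 / 2 : ℝ) - 1) * (x ^ (m + 1 / 2 - 1) * Real.exp (-((β + w) * x))) := by
    intro x hx w
    rw [show m + 1 / 2 - 1 = (m - 1) + 1 / 2 by ring, Real.rpow_add hx,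
      show -((β + w) * x) = -(β * x) + -(x * w) by ring, Real.exp_add]
    ring
  have e1 : ∫ x in Ioi (0 : ℝ), x ^ (m - 1) * Real.exp (-(β * x)) *
        (x ^ (1 / 2 : ℝ) * ∫ w in S, w ^ ((1 / 2 : ℝ) - 1) * Real.exp (-(x * w))) =
      ∫ x in Ioi (0 : ℝ), ∫ w in S,
        w ^ ((1 / 2 : ℝ) - 1) * (x ^ (m + 1 / 2 - 1) * Real.exp (-((β + w) * x))) := by
    refine setIntegral_congr_fun measurableSet_Ioi fun x hx => ?_
    simp only [← hpt x hx]
    rw [integral_const_mul, integral_const_mul]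
  rw [e1, setIntegral_swap_of_nonneg measurableSet_Ioi hS (by fun_prop), ← integral_const_mul]
  · refine setIntegral_congr_fun hS fun w hw => ?_
    have hw0 : 0 < w := hS0 hw
    rw [integral_const_mul, Real.integral_rpow_mul_exp_neg_mul_Ioi (by linarith) (by linarith)]
    ring
  · intro x hx w hw
    have hw0 : 0 < w := hS0 hw
    have hx0 : 0 < x := hx
    positivity
  · intro x hx
    simp only [← hpt x hx]
    exact (((integrableOn_rpow_mul_exp_neg_mul one_half_pos hx).mono_set hS0).const_mul
      _).const_mul _
  · intro w hw
    have hw0 : 0 < w := hS0 hw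
    exact (integrableOn_rpow_mul_exp_neg_mul (by linarith) (by linarith)).const_mul _

/-! ### Reduction to incomplete beta integrals. -/

/-- The substitution `s = w / (β + w)`. -/
lemma integral_Ioo_one_eq_incBeta {m β : ℝ} (hβ : 0 < β) :
    ∫ w in Ioo (0 : ℝ) 1, w ^ ((1 / 2 : ℝ) - 1) * (1 / (β + w)) ^ (m + 1 / 2) =
      (1 / β) ^ m * ∫ s in Ioo (0 : ℝ) (1 / (1 + β)),
        s ^ ((1 / 2 : ℝ) - 1) * (1 - s) ^ (m - 1) := by
  have himg : (fun w => w / (β + w)) '' Ioo (0 : ℝ) 1 = Ioo (0 : ℝ) (1 / (1 + β)) := by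
    ext s
    constructor
    · rintro ⟨w, ⟨h0, h1⟩, rfl⟩
      refine ⟨by positivity, ?_⟩
      simp only
      rw [div_lt_div_iff₀ (by positivity) (by positivity)]
      nlinarith
    · rintro ⟨h0, h1⟩
      rw [lt_div_iff₀ (by positivity)] at h1
      have h2 : 0 < 1 - s := by nlinarith
      refine ⟨β * s / (1 - s), ⟨by positivity, ?_⟩, ?_⟩
      · rw [div_lt_one h2]; nlinarith
      · field_simp
        ring
  have hder : ∀ w ∈ Ioo (0 : ℝ) 1,
      HasDerivWithinAt (fun w => w / (β + w)) (β / (β + w) ^ 2) (Ioo (0 : ℝ) 1) w := by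
    rintro w ⟨h0, h1⟩
    have h2 : β + w ≠ 0 := by positivity
    have := ((hasDerivAt_id w).div ((hasDerivAt_id w).const_add β) h2).hasDerivWithinAt
      (s := Ioo (0 : ℝ) 1)
    exact this.congr_deriv (by simp)
  have hmono : MonotoneOn (fun w => w / (β + w)) (Ioo (0 : ℝ) 1) := by
    rintro x ⟨hx, -⟩ y ⟨hy, -⟩ hxy
    simp only
    rw [div_le_div_iff₀ (by positivity) (by positivity)]
    nlinarith
  rw [← himg, integral_image_eq_integral_deriv_smul_of_monotoneOn measurableSet_Ioo hder hmono,
    ← integral_const_mul]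
  refine setIntegral_congr_fun measurableSet_Ioo fun w hw => ?_
  have hw0 : 0 < w := hw.1
  have hs : 0 < β + w := by positivity
  simp only [smul_eq_mul]
  -- The exponent m + 1/2 of 1/(β + w) is (1/2 - 1) + (m - 1) from the two beta factors plus 2 from
  -- the Jacobian.
  rw [show 1 - w / (β + w) = β * (1 / (β + w)) by field_simp; ring,
    show w / (β + w) = w * (1 / (β + w)) by ring, Real.mul_rpow hβ.le (by positivity),
    Real.mul_rpow hw0.le (by positivity), Real.rpow_sub_one hβ.ne', one_div β, Real.inv_rpow hβ.le,
    show m + 1 / 2 = (1 / 2 - 1) + (m - 1) + 1 + 1 by ring,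
    Real.rpow_add_one (by positivity), Real.rpow_add_one (by positivity),
    Real.rpow_add (by positivity)]
  have := (Real.rpow_pos_of_pos hβ m).ne'
  field_simp

/-- The substitution `s = β / (β + w)`. -/
lemma integral_Ioi_one_eq_incBeta {m β : ℝ} (hβ : 0 < β) :
    ∫ w in Ioi (1 : ℝ), w ^ ((1 / 2 : ℝ) - 1) * (1 / (β + w)) ^ (m + 1 / 2) =
      (1 / β) ^ m * ∫ s in Ioo (0 : ℝ) (β / (1 + β)),
        s ^ (m - 1) * (1 - s) ^ ((1 / 2 : ℝ) - 1) := by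
  have himg : (fun w => β / (β + w)) '' Ioi (1 : ℝ) = Ioo (0 : ℝ) (β / (1 + β)) := by
    ext s
    constructor
    · rintro ⟨w, h1, rfl⟩
      have h1 : 1 < w := h1
      refine ⟨by positivity, ?_⟩
      simp only
      rw [div_lt_div_iff₀ (by positivity) (by positivity)]
      nlinarith
    · rintro ⟨h0, h1⟩
      rw [lt_div_iff₀ (by positivity)] at h1
      have h2 : 0 < 1 - s := by nlinarith
      refine ⟨β * (1 - s) / s, ?_, ?_⟩
      · rw [mem_Ioi, lt_div_iff₀ h0]; nlinarith
      · field_simp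
        ring
  have hder : ∀ w ∈ Ioi (1 : ℝ),
      HasDerivWithinAt (fun w => β / (β + w)) (-(β / (β + w) ^ 2)) (Ioi (1 : ℝ)) w := by
    intro w h1
    have h1 : 1 < w := h1
    have h2 : β + w ≠ 0 := by positivity
    have := ((hasDerivAt_const w β).div ((hasDerivAt_id w).const_add β) h2).hasDerivWithinAt
      (s := Ioi (1 : ℝ))
    exact this.congr_deriv (by simp [neg_div])
  have hmono : AntitoneOn (fun w => β / (β + w)) (Ioi (1 : ℝ)) := by
    intro x hx y hy hxy
    have hx : 1 < x := hx
    simp only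
    gcongr
  rw [← himg, integral_image_eq_integral_deriv_smul_of_antitoneOn measurableSet_Ioi hder hmono,
    ← integral_const_mul]
  refine setIntegral_congr_fun measurableSet_Ioi fun w hw => ?_
  have hw0 : 0 < w := one_pos.trans hw
  have hs : 0 < β + w := by positivity
  simp only [smul_eq_mul, neg_neg]
  rw [show 1 - β / (β + w) = w * (1 / (β + w)) by field_simp; ring,
    show β / (β + w) = β * (1 / (β + w)) by ring, Real.mul_rpow hβ.le (by positivity),
    Real.mul_rpow hw0.le (by positivity), Real.rpow_sub_one hβ.ne', one_div β, Real.inv_rpow hβ.le,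
    show m + 1 / 2 = (1 / 2 - 1) + (m - 1) + 1 + 1 by ring,
    Real.rpow_add_one (by positivity), Real.rpow_add_one (by positivity),
    Real.rpow_add (by positivity)]
  have := (Real.rpow_pos_of_pos hβ m).ne'
  field_simp

/-! ### Integral representations of the Gaussian Q-function. -/

lemma integrable_exp_neg_sq_div_two : Integrable fun t : ℝ => Real.exp (-t ^ 2 / 2) := by
  have := integrable_exp_neg_mul_sq (b := 1 / 2) one_half_pos
  refine this.congr (ae_of_all _ fun t => ?_)
  simp only
  congr 1
  ring

lemma gaussQ_nonneg (z : ℝ) : 0 ≤ gaussQ z :=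
  mul_nonneg (by positivity) (integral_nonneg fun _ => (Real.exp_pos _).le)

/-- Monotonicity supplies both the measurability of Q and the bound Q ≤ 1/2 on nonnegative
arguments. -/
lemma gaussQ_antitone : Antitone gaussQ := by
  intro x y hxy
  refine mul_le_mul_of_nonneg_left ?_ (by positivity)
  exact setIntegral_mono_set integrable_exp_neg_sq_div_two.integrableOn
    (ae_of_all _ fun _ => (Real.exp_pos _).le) (Ioi_subset_Ioi hxy).eventuallyLE

lemma gaussQ_zero : gaussQ 0 = 1 / 2 := by
  have h := integral_gaussian_Ioi (1 / 2)
  have e : ∫ t in Ioi (0 : ℝ), Real.exp (-t ^ 2 / 2) = √(2 * Real.pi) / 2 := by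
    rw [show 2 * Real.pi = Real.pi / (1 / 2) by ring, ← h]
    refine integral_congr_ae (ae_of_all _ fun t => ?_)
    simp only
    congr 1
    ring
  rw [gaussQ, e]
  have : √(2 * Real.pi) ≠ 0 := by positivity
  field_simp

lemma gaussQ_sqrt_le (x : ℝ) : gaussQ √x ≤ 1 / 2 :=
  gaussQ_zero ▸ gaussQ_antitone (Real.sqrt_nonneg x)

/-- Substitute t = √(2y) r, then w = r². The form matches the inner factor of
`integral_rpow_mul_exp_mul_integral` with S = (1, ∞). -/
lemma gaussQ_sqrt_two_mul {y : ℝ} (hy : 0 < y) :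
    gaussQ √(2 * y) = (2 * √Real.pi)⁻¹ *
      (y ^ (1 / 2 : ℝ) * ∫ w in Ioi (1 : ℝ), w ^ ((1 / 2 : ℝ) - 1) * Real.exp (-(y * w))) := by
  have h2 : 0 < √(2 * y) := by positivity
  have e1 := integral_comp_mul_left_Ioi' (fun t => Real.exp (-t ^ 2 / 2)) 1 h2
  have himg : (fun r : ℝ => r ^ 2) '' Ioi 1 = Ioi 1 := by
    ext w
    constructor
    · rintro ⟨r, hr, rfl⟩
      have hr : 1 < r := hr
      simp only [mem_Ioi]
      nlinarith
    · intro hw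
      have hw : 1 < w := hw
      exact ⟨√w, by rw [mem_Ioi, Real.lt_sqrt one_pos.le]; linarith,
        Real.sq_sqrt (by linarith)⟩
  have e2 := integral_image_eq_integral_deriv_smul_of_monotoneOn (s := Ioi (1 : ℝ))
    (f := fun r : ℝ => r ^ 2) (f' := fun r => 2 * r) measurableSet_Ioi
    (fun r _ => by simpa using (hasDerivAt_pow 2 r).hasDerivWithinAt)
    (fun r hr s _ hrs => by
      have hr : 1 < r := hr
      simp only
      gcongr) (fun w => w ^ ((1 / 2 : ℝ) - 1) * Real.exp (-(y * w)))
  rw [himg] at e2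
  rw [mul_one] at e1
  rw [gaussQ, ← e1, e2, smul_eq_mul]
  have e3 : ∫ r in Ioi (1 : ℝ), (2 * r) • ((r ^ 2) ^ ((1 / 2 : ℝ) - 1) * Real.exp (-(y * r ^ 2))) =
      2 * ∫ r in Ioi (1 : ℝ), Real.exp (-(√(2 * y) * r) ^ 2 / 2) := by
    rw [← integral_const_mul]
    refine setIntegral_congr_fun measurableSet_Ioi fun r hr => ?_
    have hr0 : 0 < r := one_pos.trans hr
    simp only [smul_eq_mul]
    rw [← Real.rpow_natCast r 2, ← Real.rpow_mul hr0.le, mul_pow, Real.sq_sqrt (by positivity)]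
    have : r * r ^ ((2 : ℕ) * ((1 / 2 : ℝ) - 1)) = 1 := by
      rw [show ((2 : ℕ) * ((1 / 2 : ℝ) - 1)) = -1 by norm_num, Real.rpow_neg_one]
      field_simp
    rw [show 2 * r * (r ^ ((2 : ℕ) * ((1 / 2 : ℝ) - 1)) * Real.exp (-(y * r ^ ((2 : ℕ) : ℝ)))) =
      2 * ((r * r ^ ((2 : ℕ) * ((1 / 2 : ℝ) - 1))) * Real.exp (-(y * r ^ ((2 : ℕ) : ℝ)))) by ring,
      this, one_mul, Real.rpow_natCast]
    congr 2
    ring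
  rw [e3, ← Real.sqrt_eq_rpow, Real.sqrt_mul two_pos.le, Real.sqrt_mul two_pos.le]
  have : √(2 : ℝ) ≠ 0 := by positivity
  have : √Real.pi ≠ 0 := by positivity
  field_simp

/-- Over all of (0, ∞) the integral is Γ(1/2) y^(-1/2), which makes the right-hand side 1/2;
removing the part w > 1 removes Q. -/
lemma half_sub_gaussQ_sqrt_two_mul {y : ℝ} (hy : 0 < y) :
    1 / 2 - gaussQ √(2 * y) = (2 * √Real.pi)⁻¹ *
      (y ^ (1 / 2 : ℝ) * ∫ w in Ioo (0 : ℝ) 1, w ^ ((1 / 2 : ℝ) - 1) * Real.exp (-(y * w))) := by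
  have h := Real.integral_rpow_mul_exp_neg_mul_Ioi one_half_pos hy
  have hi := integrableOn_rpow_mul_exp_neg_mul one_half_pos hy
  rw [← Ioc_union_Ioi_eq_Ioi zero_le_one, setIntegral_union Ioc_disjoint_Ioi_same
    measurableSet_Ioi (hi.mono_set Ioc_subset_Ioi_self)
    (hi.mono_set (Ioi_subset_Ioi zero_le_one)), Real.Gamma_one_half_eq,
    integral_Ioc_eq_integral_Ioo] at h
  rw [gaussQ_sqrt_two_mul hy, eq_sub_iff_add_eq.mpr h, one_div y, Real.inv_rpow hy.le]
  have h1 : y ^ (1 / 2 : ℝ) ≠ 0 := by positivity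
  have : √Real.pi ≠ 0 := by positivity
  field_simp

/-- Craig's formula for the Gaussian Q-function, with `t = sin² θ`. -/
lemma gaussQ_craig {y : ℝ} (hy : 0 < y) :
    gaussQ √(2 * y) = (2 * Real.pi)⁻¹ *
      ∫ t in Ioo (0 : ℝ) 1,
        t ^ ((1 / 2 : ℝ) - 1) * (1 - t) ^ ((1 / 2 : ℝ) - 1) * Real.exp (-(y / t)) := by
  have himg : (fun v : ℝ => 1 / (1 + v)) '' Ioi 0 = Ioo 0 1 := by
    ext t
    constructor
    · rintro ⟨v, hv, rfl⟩
      have hv : 0 < v := hv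
      refine ⟨by positivity, ?_⟩
      simp only
      rw [div_lt_one (by positivity)]
      linarith
    · rintro ⟨h0, h1⟩
      refine ⟨(1 - t) / t, div_pos (by linarith) h0, ?_⟩
      field_simp
      ring
  have hder : ∀ v ∈ Ioi (0 : ℝ),
      HasDerivWithinAt (fun v => 1 / (1 + v)) (-(1 / (1 + v) ^ 2)) (Ioi (0 : ℝ)) v := by
    intro v hv
    have hv : 0 < v := hv
    have h2 : 1 + v ≠ 0 := by positivity
    have := ((hasDerivAt_const v (1 : ℝ)).div ((hasDerivAt_id v).const_add 1) h2).hasDerivWithinAt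
      (s := Ioi (0 : ℝ))
    exact this.congr_deriv (by simp [neg_div])
  have hmono : AntitoneOn (fun v : ℝ => 1 / (1 + v)) (Ioi (0 : ℝ)) := by
    intro x hx y hy hxy
    have hx : 0 < x := hx
    simp only
    gcongr
  rw [← himg, integral_image_eq_integral_deriv_smul_of_antitoneOn measurableSet_Ioi hder hmono]
  -- After t = 1/(1+v) the integrand is v^(-1/2) e^(-y(1+v)) / (1+v). The denominator is absorbed by
  -- writing e^(-y(1+v))/(1+v) as ∫ y e^(-y(1+v)w) dw over w > 1; swapping then leaves a Γ(1/2)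
  -- integral in v.
  have e1 : ∀ v ∈ Ioi (0 : ℝ), (-(-(1 / (1 + v) ^ 2))) • ((1 / (1 + v)) ^ ((1 / 2 : ℝ) - 1) *
      (1 - 1 / (1 + v)) ^ ((1 / 2 : ℝ) - 1) * Real.exp (-(y / (1 / (1 + v))))) =
      ∫ w in Ioi (1 : ℝ),
        y * (Real.exp (-(y * w)) * (v ^ ((1 / 2 : ℝ) - 1) * Real.exp (-(y * w * v)))) := by
    intro v hv
    have hv0 : 0 < v := hv
    have hexp := integral_exp_mul_Ioi (a := -(y * (1 + v))) (by
      have : 0 < y * (1 + v) := by positivity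
      linarith) 1
    have : ∫ w in Ioi (1 : ℝ),
        y * (Real.exp (-(y * w)) * (v ^ ((1 / 2 : ℝ) - 1) * Real.exp (-(y * w * v)))) =
        (y * v ^ ((1 / 2 : ℝ) - 1)) * ∫ w in Ioi (1 : ℝ), Real.exp (-(y * (1 + v)) * w) := by
      rw [← integral_const_mul]
      refine integral_congr_ae (ae_of_all _ fun w => ?_)
      simp only
      rw [show -(y * (1 + v)) * w = -(y * w) + -(y * w * v) by ring, Real.exp_add]
      ring
    rw [this, hexp, show 1 - 1 / (1 + v) = v * (1 / (1 + v)) by field_simp; ring,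
      Real.mul_rpow hv0.le (by positivity), smul_eq_mul]
    have h3 : (1 / (1 + v)) ^ ((1 / 2 : ℝ) - 1) * (1 / (1 + v)) ^ ((1 / 2 : ℝ) - 1) = 1 + v := by
      rw [← Real.rpow_add (by positivity), show (1 / 2 : ℝ) - 1 + (1 / 2 - 1) = -1 by norm_num,
        Real.rpow_neg_one, one_div, inv_inv]
    rw [show -(-(1 / (1 + v) ^ 2)) * ((1 / (1 + v)) ^ ((1 / 2 : ℝ) - 1) *
      (v ^ ((1 / 2 : ℝ) - 1) * (1 / (1 + v)) ^ ((1 / 2 : ℝ) - 1)) *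
        Real.exp (-(y / (1 / (1 + v))))) = 1 / (1 + v) ^ 2 * ((1 / (1 + v)) ^ ((1 / 2 : ℝ) - 1) *
        (1 / (1 + v)) ^ ((1 / 2 : ℝ) - 1)) * v ^ ((1 / 2 : ℝ) - 1) *
        Real.exp (-(y / (1 / (1 + v)))) by ring, h3,
      show -(y / (1 / (1 + v))) = -(y * (1 + v)) * 1 by field_simp]
    field_simp
  rw [setIntegral_congr_fun measurableSet_Ioi e1,
    setIntegral_swap_of_nonneg measurableSet_Ioi measurableSet_Ioi (by fun_prop)]
  · have e2 : ∀ w ∈ Ioi (1 : ℝ), ∫ v in Ioi (0 : ℝ),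
        y * (Real.exp (-(y * w)) * (v ^ ((1 / 2 : ℝ) - 1) * Real.exp (-(y * w * v)))) =
        (√Real.pi * y ^ (1 / 2 : ℝ)) * (w ^ ((1 / 2 : ℝ) - 1) * Real.exp (-(y * w))) := by
      intro w hw
      have hw0 : 0 < w := one_pos.trans hw
      rw [integral_const_mul, integral_const_mul,
        Real.integral_rpow_mul_exp_neg_mul_Ioi one_half_pos (by positivity),
        Real.Gamma_one_half_eq, one_div (y * w), Real.inv_rpow (by positivity),
        Real.mul_rpow hy.le hw0.le, Real.rpow_sub_one hw0.ne', ← Real.sqrt_eq_rpow,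
        ← Real.sqrt_eq_rpow]
      have h1 := Real.sq_sqrt hy.le
      have h2 := Real.sq_sqrt hw0.le
      have : √y ≠ 0 := by positivity
      have : √w ≠ 0 := by positivity
      field_simp
      rw [h1, h2]
    rw [setIntegral_congr_fun measurableSet_Ioi e2, integral_const_mul, gaussQ_sqrt_two_mul hy]
    have h1 := Real.sq_sqrt Real.pi_pos.le
    have : √Real.pi ≠ 0 := by positivity
    field_simp
    rw [h1]
    ring
  · intro v hv w hw
    have hv : 0 < v := hv
    positivity
  · intro v hv
    have hv : 0 < v := hv
    have := integrableOn_exp_mul_Ioi (a := -(y * (1 + v))) (by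
      have : 0 < y * (1 + v) := by positivity
      linarith) 1
    refine (this.const_mul (y * v ^ ((1 / 2 : ℝ) - 1))).congr (ae_of_all _ fun w => ?_)
    simp only
    rw [show -(y * (1 + v)) * w = -(y * w) + -(y * w * v) by ring, Real.exp_add]
    ring
  · intro w hw
    have hw0 : 0 < w := one_pos.trans hw
    exact ((integrableOn_rpow_mul_exp_neg_mul one_half_pos (by positivity)).const_mul _).const_mul _

/-! ### The incomplete beta series and the series R₂. -/

lemma beta_integrand_integrableOn {a b : ℝ} (ha : 0 < a) (hb : 0 < b) :
    IntegrableOn (fun t : ℝ => t ^ (a - 1) * (1 - t) ^ (b - 1)) (Ioo 0 1) := by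
  have h := Complex.betaIntegral_convergent (u := a) (v := b) (by simpa) (by simpa)
  rw [intervalIntegrable_iff_integrableOn_Ioo_of_le zero_le_one] at h
  refine IntegrableOn.congr_fun h.re (fun t ht => ?_) measurableSet_Ioo
  have h1 : 0 ≤ 1 - t := by linarith [ht.2]
  simp only [RCLike.re_to_complex]
  rw [← Complex.ofReal_one, ← Complex.ofReal_sub, ← Complex.ofReal_sub, ← Complex.ofReal_sub,
    ← Complex.ofReal_cpow ht.1.le, ← Complex.ofReal_cpow h1, ← Complex.ofReal_mul,
    Complex.ofReal_re]

/-- The binomial series of `(1 - x) ^ (m - 1)`. -/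
lemma hasSum_ascPochhammer_one_sub (m : ℝ) {x : ℝ} (hx : |x| < 1) :
    HasSum (fun n : ℕ => (ascPochhammer ℝ n).eval (1 - m) / n.factorial * x ^ n)
      ((1 - x) ^ (m - 1)) := by
  have h := (Real.one_div_one_sub_rpow_hasFPowerSeriesOnBall_zero (1 - m)).hasSum
    (y := x) (by simpa [enorm_eq_nnnorm, ← NNReal.coe_lt_coe] using hx)
  have h1 : (0 : ℝ) < 1 - x := by linarith [(abs_lt.mp hx).2]
  rw [zero_add, one_div, ← Real.rpow_neg h1.le, neg_sub] at h
  convert! h using 2 with n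
  rw [FormalMultilinearSeries.ofScalars_apply_eq, smul_eq_mul]
  congr 1
  -- The generalized binomial coefficient of a + n - 1 over n is (a)_n / n!, here with a = 1 - m.
  rw [Ring.choose, show (1 - m + n - 1 - n + 1 : ℝ) = 1 - m by ring, eq_comm,
    eq_div_iff (by positivity), mul_comm, ← nsmul_eq_mul,
    Ring.factorial_nsmul_multichoose_eq_ascPochhammer, Polynomial.ascPochhammer_smeval_eq_eval]

lemma summable_abs_ascPochhammer (m : ℝ) {x : ℝ} (hx0 : 0 ≤ x) (hx : x < 1) :
    Summable fun n : ℕ => |(ascPochhammer ℝ n).eval (1 - m) / n.factorial| * x ^ n := by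
  have := (hasSum_ascPochhammer_one_sub m (x := x) (by rwa [abs_of_nonneg hx0])).summable.abs
  simpa [abs_mul, abs_of_nonneg hx0] using this

lemma integral_Ioo_rpow_nat_sub_half {x : ℝ} (hx0 : 0 < x) (n : ℕ) :
    ∫ s in Ioo 0 x, s ^ ((1 / 2 : ℝ) - 1) * s ^ n = x ^ (n + 1 / 2 : ℝ) / (n + 1 / 2) := by
  have : ∫ s in Ioo 0 x, s ^ ((1 / 2 : ℝ) - 1) * s ^ n =
      ∫ s in Ioo 0 x, s ^ (n + 1 / 2 - 1 : ℝ) := by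
    refine setIntegral_congr_fun measurableSet_Ioo fun s hs => ?_
    rw [← Real.rpow_natCast s n, ← Real.rpow_add hs.1]
    congr 1
    ring
  have hn : (0 : ℝ) ≤ n := n.cast_nonneg
  rw [this, ← integral_Ioc_eq_integral_Ioo, ← intervalIntegral.integral_of_le hx0.le,
    integral_rpow (Or.inl (by linarith)), sub_add_cancel, Real.zero_rpow (by positivity), sub_zero]

lemma integrableOn_Ioo_rpow_nat_sub_half {x : ℝ} (hx0 : 0 < x) (n : ℕ) :
    IntegrableOn (fun s : ℝ => s ^ ((1 / 2 : ℝ) - 1) * s ^ n) (Ioo 0 x) := by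
  have h : IntervalIntegrable (fun s : ℝ => s ^ ((1 / 2 : ℝ) - 1)) volume 0 x :=
    intervalIntegral.intervalIntegrable_rpow' (by norm_num)
  have := h.mul_continuousOn (g := fun s => s ^ n) (by fun_prop)
  rwa [intervalIntegrable_iff_integrableOn_Ioo_of_le hx0.le] at this

/-- The series expansion of the incomplete beta function `B_x(1/2, m)`. -/
lemma hasSum_incBeta_half (m : ℝ) {x : ℝ} (hx0 : 0 < x) (hx : x < 1) :
    HasSum (fun n : ℕ => (ascPochhammer ℝ n).eval (1 - m) / n.factorial *
        (x ^ (n + 1 / 2 : ℝ) / (n + 1 / 2)))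
      (∫ s in Ioo 0 x, s ^ ((1 / 2 : ℝ) - 1) * (1 - s) ^ (m - 1)) := by
  set c : ℕ → ℝ := fun n => (ascPochhammer ℝ n).eval (1 - m) / n.factorial with hc
  have key := hasSum_integral_of_summable_integral_norm (μ := volume.restrict (Ioo 0 x))
    (F := fun n s => c n * (s ^ ((1 / 2 : ℝ) - 1) * s ^ n))
    (fun n => (integrableOn_Ioo_rpow_nat_sub_half hx0 n).const_mul _) ?_
  · simp only [integral_const_mul, integral_Ioo_rpow_nat_sub_half hx0] at key
    convert! key using 1
    refine setIntegral_congr_fun measurableSet_Ioo fun s hs => ?_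
    have hs' := hasSum_ascPochhammer_one_sub m (x := s)
      (by rw [abs_of_pos hs.1]; exact hs.2.trans hx)
    rw [← (hs'.mul_left (s ^ ((1 / 2 : ℝ) - 1))).tsum_eq]
    refine tsum_congr fun n => ?_
    simp only [hc]
    ring
  · have e : ∀ n : ℕ, ∫ s in Ioo 0 x, ‖c n * (s ^ ((1 / 2 : ℝ) - 1) * s ^ n)‖ =
        |c n| * (x ^ (n + 1 / 2 : ℝ) / (n + 1 / 2)) := by
      intro n
      rw [← integral_Ioo_rpow_nat_sub_half hx0, ← integral_const_mul]
      refine setIntegral_congr_fun measurableSet_Ioo fun s hs => ?_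
      have := hs.1
      rw [Real.norm_eq_abs, abs_mul, abs_of_pos (a := s ^ ((1 / 2 : ℝ) - 1) * s ^ n)
        (by positivity)]
    simp only [e]
    refine Summable.of_nonneg_of_le (fun n => by positivity) (fun n => ?_)
      ((summable_abs_ascPochhammer m hx0.le hx).mul_right (2 * x ^ (1 / 2 : ℝ)))
    rw [Real.rpow_add hx0, Real.rpow_natCast, mul_assoc]
    refine mul_le_mul_of_nonneg_left ?_ (abs_nonneg _)
    rw [div_le_iff₀ (by positivity)]
    have : 0 ≤ x ^ n * x ^ (1 / 2 : ℝ) * n := by positivity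
    linarith

/-- This is the part of the Euler integrand of `R₂Term` that does not depend on n; it serves as the
dominating weight. -/
lemma betaWeight_integrableOn {m b : ℝ} (hm : 0 < m) (hb : 0 < b) :
    IntegrableOn (fun t : ℝ => t ^ (m - 1 / 2) * (1 - t) ^ ((1 / 2 : ℝ) - 1) *
      (1 + b * t) ^ (-m)) (Ioo 0 1) := by
  have h := beta_integrand_integrableOn (a := m + 1 / 2) (b := 1 / 2) (by linarith) one_half_pos
  rw [show m + 1 / 2 - 1 = m - 1 / 2 by ring] at h
  refine Integrable.mono' h (Measurable.aestronglyMeasurable (by fun_prop)) ?_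
  refine ae_restrict_of_forall_mem measurableSet_Ioo fun t ht => ?_
  have h0 := ht.1
  have h1 : 0 < 1 - t := by linarith [ht.2]
  have h2 : (1 + b * t) ^ (-m) ≤ 1 :=
    Real.rpow_le_one_of_one_le_of_nonpos (by nlinarith) (by linarith)
  rw [Real.norm_of_nonneg (by positivity)]
  exact mul_le_of_le_one_right (by positivity) h2

/-- The factor B(n+m+1, 1/2) cancels the normalization of F₁, since c - a = 1/2. Splitting t^(n+m)
as t^(n+1/2) t^(m-1/2) collects the n-dependent powers into x^(n+1/2), x = t/(1 + (1+b)t), as in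
`hasSum_incBeta_half`. -/
lemma R₂Term_eq {α g m : ℝ} (hm : 0 < m) (hα : 0 < α) (hg : 0 < g) (n : ℕ) :
    R₂Term α g m n = (ProbabilityTheory.beta (1 / 2) m)⁻¹ *
      ∫ t in Ioo (0 : ℝ) 1, (ascPochhammer ℝ n).eval (1 - m) / n.factorial *
        ((t / (1 + (1 + m / (α * g)) * t)) ^ (n + 1 / 2 : ℝ) / (n + 1 / 2)) *
        (t ^ (m - 1 / 2) * (1 - t) ^ ((1 / 2 : ℝ) - 1) * (1 + m / (α * g) * t) ^ (-m)) := by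
  have hb : 0 < m / (α * g) := by positivity
  have hn : (0 : ℝ) ≤ n := n.cast_nonneg
  rw [R₂Term, appellF1, show m + n + 3 / 2 - (n + m + 1) = (1 / 2 : ℝ) by ring,
    intervalIntegral.integral_of_le zero_le_one, integral_Ioc_eq_integral_Ioo]
  generalize m / (α * g) = b at hb ⊢
  have hB := (ProbabilityTheory.beta_pos (show 0 < n + m + 1 by linarith) one_half_pos).ne'
  have hB' := (ProbabilityTheory.beta_pos one_half_pos hm).ne'
  have hf : (n.factorial : ℝ) ≠ 0 := by positivity
  have hn2 : (n + 1 / 2 : ℝ) ≠ 0 := by positivity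
  have e : ∫ t in Ioo (0 : ℝ) 1, (ascPochhammer ℝ n).eval (1 - m) / n.factorial *
        ((t / (1 + (1 + b) * t)) ^ (n + 1 / 2 : ℝ) / (n + 1 / 2)) *
        (t ^ (m - 1 / 2) * (1 - t) ^ ((1 / 2 : ℝ) - 1) * (1 + b * t) ^ (-m)) =
      (ascPochhammer ℝ n).eval (1 - m) / n.factorial / (n + 1 / 2) *
      ∫ t in Ioo (0 : ℝ) 1, t ^ (n + m + 1 - 1) * (1 - t) ^ ((1 / 2 : ℝ) - 1) *
        (1 - -b * t) ^ (-m) * (1 - -(1 + b) * t) ^ (-(n + 1 / 2 : ℝ)) := by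
    rw [← integral_const_mul]
    refine setIntegral_congr_fun measurableSet_Ioo fun t ht => ?_
    have h0 := ht.1
    rw [show 1 - -b * t = 1 + b * t by ring, show 1 - -(1 + b) * t = 1 + (1 + b) * t by ring,
      Real.div_rpow h0.le (by positivity), Real.rpow_neg (x := 1 + (1 + b) * t) (by positivity),
      show n + m + 1 - 1 = (n + 1 / 2) + (m - 1 / 2) by ring,
      Real.rpow_add h0 (n + 1 / 2) (m - 1 / 2)]
    have : (1 + (1 + b) * t) ^ (n + 1 / 2 : ℝ) ≠ 0 := by positivity
    field_simp
  rw [e]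
  generalize (∫ t in Ioo (0 : ℝ) 1, t ^ (n + m + 1 - 1) * (1 - t) ^ ((1 / 2 : ℝ) - 1) *
    (1 - -b * t) ^ (-m) * (1 - -(1 + b) * t) ^ (-(n + 1 / 2 : ℝ))) = I
  field_simp

/-- The series `R₂` as an integral of incomplete beta functions. -/
lemma hasSum_R₂Term {α g m : ℝ} (hm : 0 < m) (hα : 0 < α) (hg : 0 < g) :
    HasSum (R₂Term α g m) ((ProbabilityTheory.beta (1 / 2) m)⁻¹ *
      ∫ t in Ioo (0 : ℝ) 1, (∫ s in Ioo 0 (t / (1 + (1 + m / (α * g)) * t)),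
          s ^ ((1 / 2 : ℝ) - 1) * (1 - s) ^ (m - 1)) *
        (t ^ (m - 1 / 2) * (1 - t) ^ ((1 / 2 : ℝ) - 1) * (1 + m / (α * g) * t) ^ (-m))) := by
  rw [show R₂Term α g m = _ from funext (R₂Term_eq hm hα hg)]
  have hb : 0 < m / (α * g) := by positivity
  set b := m / (α * g)
  -- For t < 1 the denominator exceeds 2t. The bound 1/2, uniform in t, keeps the binomial series
  -- away from its singularity at 1.
  have hx : ∀ t ∈ Ioo (0 : ℝ) 1, 0 < t / (1 + (1 + b) * t) ∧ t / (1 + (1 + b) * t) ≤ 1 / 2 := by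
    rintro t ⟨h0, h1⟩
    refine ⟨by positivity, ?_⟩
    rw [div_le_iff₀ (by positivity)]
    nlinarith [mul_pos hb h0]
  have hw := betaWeight_integrableOn hm hb
  set w : ℝ → ℝ := fun t =>
    t ^ (m - 1 / 2) * (1 - t) ^ ((1 / 2 : ℝ) - 1) * (1 + b * t) ^ (-m) with hwdef
  set c : ℕ → ℝ := fun n => (ascPochhammer ℝ n).eval (1 - m) / n.factorial with hc
  have hw0 : ∀ t ∈ Ioo (0 : ℝ) 1, 0 ≤ w t := by
    rintro t ⟨h0, h1⟩
    have : 0 < 1 - t := by linarith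
    simp only [hwdef]
    positivity
  set F : ℕ → ℝ → ℝ := fun n t =>
    c n * ((t / (1 + (1 + b) * t)) ^ (n + 1 / 2 : ℝ) / (n + 1 / 2)) * w t with hF
  -- The factor 2 bounds 1/(n + 1/2).
  have hbound : ∀ n, ∀ t ∈ Ioo (0 : ℝ) 1, ‖F n t‖ ≤ |c n| * (1 / 2) ^ n * 2 * w t := by
    intro n t ht
    obtain ⟨hx0, hx1⟩ := hx t ht
    simp only [hF]
    rw [Real.norm_eq_abs, abs_mul, abs_mul, abs_of_nonneg (hw0 t ht), abs_of_pos
      (a := (t / (1 + (1 + b) * t)) ^ (n + 1 / 2 : ℝ) / (n + 1 / 2)) (by positivity),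
      mul_assoc |c n| ((1 / 2) ^ n)]
    refine mul_le_mul_of_nonneg_right (mul_le_mul_of_nonneg_left ?_ (abs_nonneg _)) (hw0 t ht)
    rw [div_le_iff₀ (by positivity), Real.rpow_add hx0, Real.rpow_natCast]
    have h3 : (t / (1 + (1 + b) * t)) ^ n ≤ (1 / 2) ^ n := by gcongr
    have h4 : (t / (1 + (1 + b) * t)) ^ (1 / 2 : ℝ) ≤ 1 :=
      Real.rpow_le_one hx0.le (by linarith) (by norm_num)
    have h5 : 0 ≤ (1 / 2 : ℝ) ^ n * n := by positivity
    have h6 : (t / (1 + (1 + b) * t)) ^ n * (t / (1 + (1 + b) * t)) ^ (1 / 2 : ℝ) ≤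
        (1 / 2) ^ n * 1 := by gcongr
    linarith
  have hFi : ∀ n, IntegrableOn (F n) (Ioo 0 1) := fun n =>
    Integrable.mono' (hw.const_mul (|c n| * (1 / 2) ^ n * 2))
      (Measurable.aestronglyMeasurable (by fun_prop))
      (ae_restrict_of_forall_mem measurableSet_Ioo (hbound n))
  have key := hasSum_integral_of_summable_integral_norm hFi ?_
  · refine HasSum.mul_left _ ?_
    convert! key using 1
    refine setIntegral_congr_fun measurableSet_Ioo fun t ht => ?_
    obtain ⟨hx0, hx1⟩ := hx t ht
    exact (((hasSum_incBeta_half m hx0 (by linarith)).mul_right (w t)).tsum_eq).symm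
  · refine Summable.of_nonneg_of_le (fun n => integral_nonneg fun _ => norm_nonneg _)
      (fun n => setIntegral_mono_on (hFi n).norm (hw.const_mul (|c n| * (1 / 2) ^ n * 2))
        measurableSet_Ioo (hbound n)) ?_
    simp only [integral_const_mul]
    exact ((summable_abs_ascPochhammer m (x := 1 / 2) (by norm_num) (by norm_num)).mul_right
      2).mul_right _

/-! ### Averages of Q and of Q(1/2 - Q) over the SNR. -/

lemma snrPDF_of_nonneg (m g : ℝ) {x : ℝ} (hx : 0 ≤ x) :
    snrPDF m g x = (m / g) ^ m / Real.Gamma m * (x ^ (m - 1) * Real.exp (-(m / g * x))) := by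
  rw [snrPDF, ProbabilityTheory.gammaPDFReal, if_pos hx]
  ring

lemma snrPDF_integrableOn {m g : ℝ} (hm : 0 < m) (hg : 0 < g) :
    IntegrableOn (snrPDF m g) (Ioi 0) := by
  refine IntegrableOn.congr_fun
    ((integrableOn_rpow_mul_exp_neg_mul hm (div_pos hm hg)).const_mul
      ((m / g) ^ m / Real.Gamma m)) (fun x hx => ?_) measurableSet_Ioi
  exact (snrPDF_of_nonneg m g (le_of_lt hx)).symm

lemma gaussQ_measurable : Measurable gaussQ := gaussQ_antitone.measurable

lemma hasAverageBER_of_bounded {ber : ℝ → ℝ} (hber : Measurable ber) (C : ℝ)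
    (hC : ∀ x, |ber x| ≤ C) {m g : ℝ} (hm : 0 < m) (hg : 0 < g) : HasAverageBER ber m g :=
  (snrPDF_integrableOn hm hg).bdd_mul hber.aestronglyMeasurable (ae_of_all _ hC)

lemma hasAverageBER_gaussQ_sqrt (α : ℝ) {m g : ℝ} (hm : 0 < m) (hg : 0 < g) :
    HasAverageBER (fun x => gaussQ √(α * x)) m g := by
  refine hasAverageBER_of_bounded (gaussQ_measurable.comp (by fun_prop)) (1 / 2) (fun x => ?_) hm hg
  rw [Function.comp_apply, abs_of_nonneg (gaussQ_nonneg _)]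
  exact gaussQ_sqrt_le _

lemma hasAverageBER_gaussQ_sqrt_sq (α : ℝ) {m g : ℝ} (hm : 0 < m) (hg : 0 < g) :
    HasAverageBER (fun x => gaussQ √(α * x) ^ 2) m g := by
  refine hasAverageBER_of_bounded
    ((gaussQ_measurable.comp (by fun_prop : Measurable fun x => √(α * x))).pow_const 2)
    1 (fun x => ?_) hm hg
  have h1 := gaussQ_sqrt_le (α * x)
  have h0 := gaussQ_nonneg √(α * x)
  rw [Function.comp_apply, abs_of_nonneg (by positivity)]
  nlinarith

lemma averageBER_comp_mul (h : ℝ → ℝ) {α m g : ℝ} (hα : 0 < α) (hm : 0 < m) (hg : 0 < g) :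
    averageBER (fun x => h (α * x)) m g = (m / (α * g)) ^ m / Real.Gamma m *
      ∫ z in Ioi (0 : ℝ), z ^ (m - 1) * Real.exp (-(m / (α * g) * z)) * h z := by
  have e := integral_comp_mul_left_Ioi'
    (fun z => z ^ (m - 1) * Real.exp (-(m / (α * g) * z)) * h z) 0 hα
  rw [mul_zero] at e
  rw [← e, averageBER, smul_eq_mul, ← integral_const_mul, ← integral_const_mul]
  refine setIntegral_congr_fun measurableSet_Ioi fun x hx => ?_
  have hx0 : 0 < x := hx
  have hG := (Real.Gamma_pos_of_pos hm).ne'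
  rw [snrPDF_of_nonneg m g hx0.le, show m / g = α * (m / (α * g)) by field_simp,
    Real.mul_rpow hα.le (by positivity), Real.mul_rpow hα.le hx0.le, Real.rpow_sub_one hα.ne',
    show -(α * (m / (α * g)) * x) = -(m / (α * g) * (α * x)) by ring]
  field_simp

lemma regIncBeta_eq {x : ℝ} (hx : 0 ≤ x) (a b : ℝ) :
    regIncBeta x a b =
      (∫ t in Ioo 0 x, t ^ (a - 1) * (1 - t) ^ (b - 1)) / ProbabilityTheory.beta a b := by
  rw [regIncBeta, intervalIntegral.integral_of_le hx, integral_Ioc_eq_integral_Ioo]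

lemma averageBER_gaussQ {α m g : ℝ} (hα : 0 < α) (hm : 0 < m) (hg : 0 < g) :
    averageBER (fun x => gaussQ √(2 * (α * x))) m g =
      1 / 2 * regIncBeta (m / (m + α * g)) m (1 / 2) := by
  rw [averageBER_comp_mul (fun y => gaussQ √(2 * y)) hα hm hg, regIncBeta_eq (by positivity)]
  have hb : 0 < m / (α * g) := by positivity
  have hx : m / (m + α * g) = m / (α * g) / (1 + m / (α * g)) := by
    field_simp
    ring
  rw [hx]
  set b := m / (α * g)
  have e : ∫ z in Ioi (0 : ℝ), z ^ (m - 1) * Real.exp (-(b * z)) * gaussQ √(2 * z) =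
      (2 * √Real.pi)⁻¹ * ∫ z in Ioi (0 : ℝ), z ^ (m - 1) * Real.exp (-(b * z)) *
        (z ^ (1 / 2 : ℝ) * ∫ w in Ioi (1 : ℝ),
          w ^ ((1 / 2 : ℝ) - 1) * Real.exp (-(z * w))) := by
    rw [← integral_const_mul]
    refine setIntegral_congr_fun measurableSet_Ioi fun z hz => ?_
    simp only [gaussQ_sqrt_two_mul hz]
    ring
  rw [e, integral_rpow_mul_exp_mul_integral hm hb measurableSet_Ioi (Ioi_subset_Ioi zero_le_one),
    integral_Ioi_one_eq_incBeta hb, ProbabilityTheory.beta, Real.Gamma_one_half_eq, one_div b,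
    Real.inv_rpow hb.le]
  have hG := (Real.Gamma_pos_of_pos hm).ne'
  have hG' := (Real.Gamma_pos_of_pos (show 0 < m + 1 / 2 by linarith)).ne'
  have : b ^ m ≠ 0 := by positivity
  have : √Real.pi ≠ 0 := by positivity
  field_simp

/-- The product Q(1/2 - Q) is used rather than Q² because 1/2 - Q lives on 0 < w < 1, which produces
B_x(1/2, m) with small x, the integral that R₂ expands. -/
lemma averageBER_gaussQ_mul_half_sub {α m g : ℝ} (hα : 0 < α) (hm : 0 < m) (hg : 0 < g) :
    averageBER (fun x => gaussQ √(2 * (α * x)) * (1 / 2 - gaussQ √(2 * (α * x)))) m g =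
      R₂ α g m := by
  rw [averageBER_comp_mul (fun y => gaussQ √(2 * y) * (1 / 2 - gaussQ √(2 * y))) hα hm hg, R₂,
    (hasSum_R₂Term hm hα hg).tsum_eq]
  have hb : 0 < m / (α * g) := by positivity
  set b := m / (α * g)
  set I := ∫ t in Ioo (0 : ℝ) 1, (∫ s in Ioo 0 (t / (1 + (1 + b) * t)),
      s ^ ((1 / 2 : ℝ) - 1) * (1 - s) ^ (m - 1)) *
    (t ^ (m - 1 / 2) * (1 - t) ^ ((1 / 2 : ℝ) - 1) * (1 + b * t) ^ (-m)) with hI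
  have hD : Measurable fun z => 1 / 2 - gaussQ √(2 * z) :=
    (gaussQ_measurable.comp (by fun_prop : Measurable fun z : ℝ => √(2 * z))).const_sub _
  have hD0 : ∀ z, 0 ≤ 1 / 2 - gaussQ √(2 * z) := fun z => sub_nonneg.mpr (gaussQ_sqrt_le _)
  have hD1 : ∀ z, ‖1 / 2 - gaussQ √(2 * z)‖ ≤ 1 / 2 := fun z => by
    rw [Real.norm_of_nonneg (hD0 z)]
    linarith [gaussQ_nonneg √(2 * z)]
  set D : ℝ → ℝ := fun z => 1 / 2 - gaussQ √(2 * z) with hDdef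
  set k : ℝ → ℝ := fun t => t ^ ((1 / 2 : ℝ) - 1) * (1 - t) ^ ((1 / 2 : ℝ) - 1) with hk
  have hkm : Measurable k := by simp only [hk]; fun_prop
  have hk0 : ∀ t ∈ Ioo (0 : ℝ) 1, 0 ≤ k t := by
    rintro t ⟨h0, h1⟩
    have : 0 < 1 - t := by linarith
    simp only [hk]
    positivity
  have hki : IntegrableOn k (Ioo 0 1) := beta_integrand_integrableOn one_half_pos one_half_pos
  -- Only Q is expanded here; D = 1/2 - Q stays a bounded nonnegative factor, so the interchange
  -- involves just z and t.
  have e1 : ∫ z in Ioi (0 : ℝ), z ^ (m - 1) * Real.exp (-(b * z)) * (gaussQ √(2 * z) * D z) =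
      (2 * Real.pi)⁻¹ * ∫ z in Ioi (0 : ℝ), ∫ t in Ioo (0 : ℝ) 1,
        (z ^ (m - 1) * Real.exp (-(b * z)) * D z) * (k t * Real.exp (-(z / t))) := by
    rw [← integral_const_mul]
    refine setIntegral_congr_fun measurableSet_Ioi fun z hz => ?_
    simp only [hk]
    rw [integral_const_mul, gaussQ_craig hz]
    ring
  have e2 : ∀ t ∈ Ioo (0 : ℝ) 1, ∫ z in Ioi (0 : ℝ),
      (z ^ (m - 1) * Real.exp (-(b * z)) * D z) * (k t * Real.exp (-(z / t))) =
      (2 * √Real.pi)⁻¹ * Real.Gamma (m + 1 / 2) *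
        ((∫ s in Ioo 0 (t / (1 + (1 + b) * t)), s ^ ((1 / 2 : ℝ) - 1) * (1 - s) ^ (m - 1)) *
        (t ^ (m - 1 / 2) * (1 - t) ^ ((1 / 2 : ℝ) - 1) * (1 + b * t) ^ (-m))) := by
    rintro t ⟨h0, h1⟩
    -- With β = b + 1/t, the endpoint 1/(1+β) is x = t/(1 + (1+b)t), and β^(-m) = t^m (1 + bt)^(-m)
    -- supplies the remaining weight.
    have hβ : 0 < b + 1 / t := by positivity
    have e3 : ∫ z in Ioi (0 : ℝ),
        (z ^ (m - 1) * Real.exp (-(b * z)) * D z) * (k t * Real.exp (-(z / t))) =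
        k t * (2 * √Real.pi)⁻¹ * ∫ z in Ioi (0 : ℝ),
          z ^ (m - 1) * Real.exp (-((b + 1 / t) * z)) *
          (z ^ (1 / 2 : ℝ) * ∫ w in Ioo (0 : ℝ) 1,
            w ^ ((1 / 2 : ℝ) - 1) * Real.exp (-(z * w))) := by
      rw [← integral_const_mul]
      refine setIntegral_congr_fun measurableSet_Ioi fun z hz => ?_
      simp only [hDdef]
      rw [half_sub_gaussQ_sqrt_two_mul hz,
        show -((b + 1 / t) * z) = -(b * z) + -(z / t) by ring, Real.exp_add]
      ring
    rw [e3, integral_rpow_mul_exp_mul_integral hm hβ measurableSet_Ioo Ioo_subset_Ioi_self,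
      integral_Ioo_one_eq_incBeta hβ,
      show 1 / (1 + (b + 1 / t)) = t / (1 + (1 + b) * t) by field_simp; ring,
      show 1 / (b + 1 / t) = t * (1 + b * t)⁻¹ by field_simp; ring,
      Real.mul_rpow h0.le (by positivity), Real.inv_rpow (by positivity),
      Real.rpow_neg (by positivity), show m - 1 / 2 = (1 / 2 - 1) + m by ring, Real.rpow_add h0]
    simp only [hk]
    ring
  rw [e1, setIntegral_swap_of_nonneg measurableSet_Ioi measurableSet_Ioo (by fun_prop),
    setIntegral_congr_fun measurableSet_Ioo e2, integral_const_mul, ← hI, ProbabilityTheory.beta,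
    Real.Gamma_one_half_eq, add_comm (1 / 2) m]
  · clear_value I
    have hG := (Real.Gamma_pos_of_pos hm).ne'
    have hG' := (Real.Gamma_pos_of_pos (show 0 < m + 1 / 2 by linarith)).ne'
    have : √Real.pi ≠ 0 := by positivity
    field_simp
    ring
  · intro z hz t ht
    have hz0 : 0 < z := hz
    have := hk0 t ht
    have := hD0 z
    positivity
  · intro z hz
    have hz0 : 0 < z := hz
    refine Integrable.const_mul ?_ _
    refine Integrable.mono' hki (Measurable.aestronglyMeasurable (by fun_prop)) ?_
    refine ae_restrict_of_forall_mem measurableSet_Ioo fun t ht => ?_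
    have := ht.1
    have := hk0 t ht
    rw [Real.norm_of_nonneg (by positivity)]
    refine mul_le_of_le_one_right this (Real.exp_le_one_iff.mpr ?_)
    have : 0 ≤ z / t := by positivity
    linarith
  · intro t ht
    have h0 := ht.1
    have hW := (integrableOn_rpow_mul_exp_neg_mul hm hb).mul_bdd
      hD.aestronglyMeasurable (ae_of_all _ hD1)
    refine Integrable.mono' (hW.norm.mul_const (k t)) (Measurable.aestronglyMeasurable
      (by fun_prop)) (ae_restrict_of_forall_mem measurableSet_Ioi fun z hz => ?_)
    have hz0 : 0 < z := hz
    have hkt := hk0 t ht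
    have : 0 ≤ z / t := by positivity
    rw [norm_mul, norm_mul (k t), Real.norm_of_nonneg hkt, Real.norm_of_nonneg (Real.exp_pos _).le]
    refine mul_le_mul_of_nonneg_left ?_ (norm_nonneg _)
    exact mul_le_of_le_one_right hkt (Real.exp_le_one_iff.mpr (by linarith))

/-! ### Assembling the bit error rates. -/

/-- Average the identity Q² = Q/2 - Q(1/2 - Q). -/
lemma averageBER_gaussQ_sq {α m g : ℝ} (hα : 0 < α) (hm : 0 < m) (hg : 0 < g) :
    averageBER (fun x => gaussQ √(2 * α * x) ^ 2) m g =
      1 / 4 * regIncBeta (m / (m + α * g)) m (1 / 2) - R₂ α g m := by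
  have h1 := averageBER_gaussQ hα hm hg
  have h2 := averageBER_gaussQ_mul_half_sub hα hm hg
  have i1 := hasAverageBER_gaussQ_sqrt (2 * α) hm hg
  have i2 := hasAverageBER_gaussQ_sqrt_sq (2 * α) hm hg
  simp only [← mul_assoc] at h1 h2
  have key : averageBER (fun x => gaussQ √(2 * α * x) * (1 / 2 - gaussQ √(2 * α * x))) m g =
      1 / 2 * averageBER (fun x => gaussQ √(2 * α * x)) m g -
        averageBER (fun x => gaussQ √(2 * α * x) ^ 2) m g := by
    simp only [averageBER]
    rw [← integral_const_mul, ← integral_sub (i1.const_mul _) i2]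
    refine integral_congr_ae (ae_of_all _ fun x => ?_)
    simp only
    ring
  linarith

lemma hasAverageBER_berAp (a₁ : ℝ) (a₂ : ℕ → ℝ) (a₃ : ℕ) {m g : ℝ} (hm : 0 < m) (hg : 0 < g) :
    HasAverageBER (berAp a₁ a₂ a₃) m g := by
  have := (integrable_finsetSum (Finset.Icc 1 a₃)
    fun j _ => hasAverageBER_gaussQ_sqrt (a₂ j) hm hg).const_mul a₁
  refine this.congr (ae_of_all _ fun x => ?_)
  simp only [berAp, ← Finset.sum_mul]
  ring

lemma averageBER_berAp (a₁ : ℝ) (a₂ : ℕ → ℝ) (a₃ : ℕ) {m g : ℝ} (hm : 0 < m) (hg : 0 < g)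
    (ha : ∀ j ∈ Finset.Icc 1 a₃, 0 < a₂ j) :
    averageBER (berAp a₁ (fun j => 2 * a₂ j) a₃) m g =
      a₁ / 2 * ∑ j ∈ Finset.Icc 1 a₃, regIncBeta (m / (m + a₂ j * g)) m (1 / 2) := by
  have e : averageBER (berAp a₁ (fun j => 2 * a₂ j) a₃) m g =
      a₁ * ∑ j ∈ Finset.Icc 1 a₃, averageBER (fun x => gaussQ √(2 * (a₂ j * x))) m g := by
    simp only [averageBER, ← mul_assoc]
    rw [← integral_finsetSum _ fun j _ => hasAverageBER_gaussQ_sqrt (2 * a₂ j) hm hg,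
      ← integral_const_mul]
    refine integral_congr_ae (ae_of_all _ fun x => ?_)
    simp only [berAp, ← Finset.sum_mul]
    ring
  rw [e, Finset.sum_congr rfl fun j hj => averageBER_gaussQ (ha j hj) hm hg, ← Finset.mul_sum]
  ring

lemma c₁_pos {M : ℕ} (hM : 2 ≤ M) : 0 < c₁ M := by
  have h : (2 : ℝ) ≤ M := by exact_mod_cast hM
  have := Real.logb_pos one_lt_two (show (1 : ℝ) < M by linarith)
  have : (0 : ℝ) < M - 1 := by linarith
  rw [c₁]
  positivity

lemma odd_sq_pos {n j : ℕ} (hj : j ∈ Finset.Icc 1 n) : 0 < (2 * (j : ℝ) - 1) ^ 2 := by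
  have : (1 : ℝ) ≤ j := by exact_mod_cast (Finset.mem_Icc.mp hj).1
  have : 0 < 2 * (j : ℝ) - 1 := by linarith
  positivity

end NakagamiQAM

end

theorem theorem4 (M : ℕ) (hM : 2 ≤ M) (m : ℝ) (hm : 0 < m) (g : ℝ) (hg : 0 < g) :
    -- The exact average bit error rate
    (NakagamiQAM.HasAverageBER (NakagamiQAM.berTh M) m g ∧
      Summable (NakagamiQAM.R₂Term (NakagamiQAM.c₁ M) g m) ∧
      NakagamiQAM.averageBER (NakagamiQAM.berTh M) m g =
        NakagamiQAM.c₀ M * (2 - NakagamiQAM.c₀ M) *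
            NakagamiQAM.regIncBeta (m / (m + NakagamiQAM.c₁ M * g)) m (1 / 2) +
          4 * NakagamiQAM.c₀ M ^ 2 * NakagamiQAM.R₂ (NakagamiQAM.c₁ M) g m) ∧
    -- The approximate one, with `a₂(j) = 2 c₁ (2j - 1)²`
    (NakagamiQAM.HasAverageBER
        (NakagamiQAM.berAp (4 * NakagamiQAM.c₀ M)
          (fun j => 2 * NakagamiQAM.c₁ M * (2 * (j : ℝ) - 1) ^ 2) ⌊√(M : ℝ) / 2⌋₊) m g ∧
      NakagamiQAM.averageBER
        (NakagamiQAM.berAp (4 * NakagamiQAM.c₀ M)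
          (fun j => 2 * NakagamiQAM.c₁ M * (2 * (j : ℝ) - 1) ^ 2) ⌊√(M : ℝ) / 2⌋₊) m g =
        2 * NakagamiQAM.c₀ M * ∑ j ∈ Finset.Icc 1 ⌊√(M : ℝ) / 2⌋₊,
          NakagamiQAM.regIncBeta
            (m / (m + NakagamiQAM.c₁ M * (2 * (j : ℝ) - 1) ^ 2 * g)) m (1 / 2)) ∧
    -- The approximate one, with `a₂(j) = c₁ (2j - 1)²`
    (NakagamiQAM.HasAverageBER
        (NakagamiQAM.berAp (4 * NakagamiQAM.c₀ M)
          (fun j => NakagamiQAM.c₁ M * (2 * (j : ℝ) - 1) ^ 2) ⌊√(M : ℝ) / 2⌋₊) m g ∧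
      NakagamiQAM.averageBER
        (NakagamiQAM.berAp (4 * NakagamiQAM.c₀ M)
          (fun j => NakagamiQAM.c₁ M * (2 * (j : ℝ) - 1) ^ 2) ⌊√(M : ℝ) / 2⌋₊) m g =
        2 * NakagamiQAM.c₀ M * ∑ j ∈ Finset.Icc 1 ⌊√(M : ℝ) / 2⌋₊,
          NakagamiQAM.regIncBeta
            (m / (m + NakagamiQAM.c₁ M / 2 * (2 * (j : ℝ) - 1) ^ 2 * g)) m (1 / 2)) := by
  have hc := NakagamiQAM.c₁_pos hM
  -- For real series, `Summable` is absolute convergence.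
  refine ⟨⟨?_, (NakagamiQAM.hasSum_R₂Term hm hc hg).summable, ?_⟩,
    ⟨NakagamiQAM.hasAverageBER_berAp _ _ _ hm hg, ?_⟩,
    ⟨NakagamiQAM.hasAverageBER_berAp _ _ _ hm hg, ?_⟩⟩
  · have i1 := (NakagamiQAM.hasAverageBER_gaussQ_sqrt (2 * NakagamiQAM.c₁ M) hm hg).const_mul
      (4 * NakagamiQAM.c₀ M)
    have i2 := (NakagamiQAM.hasAverageBER_gaussQ_sqrt_sq (2 * NakagamiQAM.c₁ M) hm hg).const_mul
      (4 * NakagamiQAM.c₀ M ^ 2)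
    refine (i1.sub i2).congr (MeasureTheory.ae_of_all _ fun x => ?_)
    simp only [NakagamiQAM.berTh, Pi.sub_apply]
    ring
  · have i1 := (NakagamiQAM.hasAverageBER_gaussQ_sqrt (2 * NakagamiQAM.c₁ M) hm hg).const_mul
      (4 * NakagamiQAM.c₀ M)
    have i2 := (NakagamiQAM.hasAverageBER_gaussQ_sqrt_sq (2 * NakagamiQAM.c₁ M) hm hg).const_mul
      (4 * NakagamiQAM.c₀ M ^ 2)
    have e : NakagamiQAM.averageBER (NakagamiQAM.berTh M) m g =
        4 * NakagamiQAM.c₀ M * NakagamiQAM.averageBER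
          (fun x => NakagamiQAM.gaussQ √(2 * NakagamiQAM.c₁ M * x)) m g -
        4 * NakagamiQAM.c₀ M ^ 2 * NakagamiQAM.averageBER
          (fun x => NakagamiQAM.gaussQ √(2 * NakagamiQAM.c₁ M * x) ^ 2) m g := by
      simp only [NakagamiQAM.averageBER]
      rw [← MeasureTheory.integral_const_mul, ← MeasureTheory.integral_const_mul,
        ← MeasureTheory.integral_sub i1 i2]
      refine MeasureTheory.integral_congr_ae (MeasureTheory.ae_of_all _ fun x => ?_)
      simp only [NakagamiQAM.berTh]
      ring
    have h1 := NakagamiQAM.averageBER_gaussQ hc hm hg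
    simp only [← mul_assoc] at h1
    -- With I the regularized beta value, 4c₀ · I/2 - 4c₀² (I/4 - R₂) = c₀(2 - c₀) I + 4c₀² R₂.
    rw [e, h1, NakagamiQAM.averageBER_gaussQ_sq hc hm hg]
    ring
  · have h := NakagamiQAM.averageBER_berAp (4 * NakagamiQAM.c₀ M)
      (fun j => NakagamiQAM.c₁ M * (2 * (j : ℝ) - 1) ^ 2) ⌊√(M : ℝ) / 2⌋₊ hm hg
      fun j hj => mul_pos hc (NakagamiQAM.odd_sq_pos hj)
    simp only [← mul_assoc] at h
    rw [h]
    ring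
  -- Without the factor 2 in the argument, c₁ is read as 2 · (c₁/2).
  · have h := NakagamiQAM.averageBER_berAp (4 * NakagamiQAM.c₀ M)
      (fun j => NakagamiQAM.c₁ M / 2 * (2 * (j : ℝ) - 1) ^ 2) ⌊√(M : ℝ) / 2⌋₊ hm hg
      fun j hj => mul_pos (half_pos hc) (NakagamiQAM.odd_sq_pos hj)
    simp only [← mul_assoc, mul_div_cancel₀ (NakagamiQAM.c₁ M) (two_ne_zero' ℝ)] at h
    rw [h]
    ring
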